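/- Let $K$ be a field of characteristic zero and let $A=\bigoplus_{i\ge 0}A_i$ be a standard graded Artinian $K$-algebra, that is, a nonzero commutative graded Artinian $K$-algebra with $A_0=K$ that is generated by $A_1$ as a $K$-algebra. Elements of $A_1$ are called linear forms. For a graded $K$-algebra $B=\bigoplus_{i=0}^{c}B_i$ with $B_c\neq 0$, say that - $B$ has the weak Lefschetz property (WLP) if there is $g\in B_1$ such that for every $i=0,1,\dots,c-1$ the multiplication map $\times g: B_i\to B_{i+1}$ is injective or surjective; - $B$ has the strong Lefschetz property (SLP) if there is $g\in B_1$ such that for every $i=0,1,\dots,\lfloor c/2\rfloor$ the multiplication map $\times g^{\,c-2i}: B_i\to B_{c-i}$ is bijective. For a linear form $z\in A_1$ let $$\mathrm{Gr}_{(z)}(A)=\bigoplus_{j\ge 0}(z^j)/(z^{j+1})$$ be the associated graded ring of $A$ with respect to the ideal $(z)$, with multiplication $(a+(z^{j+1}))(b+(z^{k+1}))=ab+(z^{j+k+1})$ for $a\in(z^j)$, $b\in(z^k)$. It is regarded as a graded $K$-algebra through the grading inherited from $A$: its component of degree $i$ is the direct sum over $j$ of the images of $(z^j)\cap A_i$ in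 $(z^j)/(z^{j+1})$. Then: 1. $A$ has the WLP if and only if there is a linear form $z\in A_1$ such that $\mathrm{Gr}_{(z)}(A)$ has the WLP. 2. $A$ has the SLP if and only if there is a linear form $z\in A_1$ such that $\mathrm{Gr}_{(z)}(A)$ has the SLP. -/

import Mathlib

open scoped DirectSum

universe u v

noncomputable section

/-- The `n`-th piece `I ^ n / I ^ (n + 1)` of the associated graded ring of an ideal `I`. -/
def GrPiece {A : Type v} [CommRing A] (I : Ideal A) (n : ℕ) : Type v :=
  ↥(I ^ n) ⧸ Submodule.comap (I ^ n).subtype (I ^ (n + 1))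

namespace GrPiece

variable {A : Type v} [CommRing A] {I : Ideal A}

instance (n : ℕ) : AddCommGroup (GrPiece I n) :=
  inferInstanceAs
    (AddCommGroup (↥(I ^ n) ⧸ Submodule.comap (I ^ n).subtype (I ^ (n + 1))))

instance {K : Type u} [CommRing K] [Algebra K A] (n : ℕ) : Module K (GrPiece I n) :=
  inferInstanceAs
    (Module K (↥(I ^ n) ⧸ Submodule.comap (I ^ n).subtype (I ^ (n + 1))))

/-- The class `a + I ^ (n + 1)` of an element `a ∈ I ^ n`. -/
def mk {n : ℕ} (a : ↥(I ^ n)) : GrPiece I n :=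
  Submodule.Quotient.mk (p := Submodule.comap (I ^ n).subtype (I ^ (n + 1))) a

theorem mk_eq_mk {n : ℕ} {a b : ↥(I ^ n)} :
    mk a = mk b ↔ (a : A) - (b : A) ∈ I ^ (n + 1) := by
  exact (Submodule.Quotient.eq (Submodule.comap (I ^ n).subtype (I ^ (n + 1)))).trans (by simp)

theorem mk_surjective {n : ℕ} (x : GrPiece I n) : ∃ a : ↥(I ^ n), mk a = x :=
  Submodule.Quotient.mk_surjective _ x

theorem mk_add {n : ℕ} (a b : ↥(I ^ n)) : mk (a + b) = mk a + mk b := rfl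

theorem mk_zero {n : ℕ} : mk (0 : ↥(I ^ n)) = 0 := rfl

theorem mk_smul {K : Type u} [CommRing K] [Algebra K A] {n : ℕ} (k : K) (a : ↥(I ^ n)) :
    mk (k • a) = k • mk a := rfl

/-- The quotient map `I ^ n → I ^ n / I ^ (n + 1)` as a `K`-linear map. -/
def mkLinear (K : Type u) [CommRing K] [Algebra K A] (I : Ideal A) (n : ℕ) :
    ↥(I ^ n) →ₗ[K] GrPiece I n where
  toFun := mk
  map_add' := mk_add
  map_smul' := mk_smul

/-- The product of `a ∈ I ^ m` and `b ∈ I ^ n` as an element of `I ^ (m + n)`. -/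
def mulRep {m n : ℕ} (a : ↥(I ^ m)) (b : ↥(I ^ n)) : ↥(I ^ (m + n)) :=
  ⟨(a : A) * (b : A), by rw [pow_add]; exact Ideal.mul_mem_mul a.2 b.2⟩

theorem mulRep_congr {m n : ℕ} {a a' : ↥(I ^ m)} {b b' : ↥(I ^ n)}
    (ha : mk a = mk a') (hb : mk b = mk b') : mk (mulRep a b) = mk (mulRep a' b') := by
  rw [mk_eq_mk] at *
  have h1 : ((a : A) - a') * b ∈ I ^ (m + n + 1) := by
    have h := Ideal.mul_mem_mul ha b.2
    rwa [← pow_add, show m + 1 + n = m + n + 1 by omega] at h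
  have h2 : (a' : A) * ((b : A) - b') ∈ I ^ (m + n + 1) := by
    have h := Ideal.mul_mem_mul a'.2 hb
    rwa [← pow_add, show m + (n + 1) = m + n + 1 by omega] at h
  have h3 := Ideal.add_mem _ h1 h2
  have e : ((a : A) - a') * b + (a' : A) * ((b : A) - b') = (a : A) * b - a' * b' := by ring
  rw [e] at h3
  exact h3

/-- The multiplication `(a + I ^ (m + 1)) (b + I ^ (n + 1)) = a b + I ^ (m + n + 1)`;
see `mul_mk_mk`. -/
def mul {m n : ℕ} (x : GrPiece I m) (y : GrPiece I n) : GrPiece I (m + n) :=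
  mk (mulRep (mk_surjective x).choose (mk_surjective y).choose)

theorem mul_mk_mk {m n : ℕ} (a : ↥(I ^ m)) (b : ↥(I ^ n)) :
    mul (mk a) (mk b) = mk (mulRep a b) :=
  mulRep_congr (mk_surjective (mk a)).choose_spec (mk_surjective (mk b)).choose_spec

/-- The class of an element of `A` in `I ^ 0 / I ^ 1 = A / I`. -/
def zeroRep (a : A) : ↥(I ^ 0) := ⟨a, by simp⟩

theorem sigma_mk_eq {m n : ℕ} (h : m = n) (a : ↥(I ^ m)) (b : ↥(I ^ n))
    (hab : (a : A) = (b : A)) :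
    (GradedMonoid.mk m (mk a) : GradedMonoid (GrPiece I)) = GradedMonoid.mk n (mk b) := by
  subst h
  rw [Subtype.ext hab]

instance gMul : GradedMonoid.GMul (GrPiece I) := ⟨mul⟩

instance gOne : GradedMonoid.GOne (GrPiece I) := ⟨mk (zeroRep 1)⟩

theorem gMul_mk_mk {m n : ℕ} (a : ↥(I ^ m)) (b : ↥(I ^ n)) :
    GradedMonoid.GMul.mul (mk a) (mk b) = mk (mulRep a b) := mul_mk_mk a b

instance gCommRing : DirectSum.GCommRing (GrPiece I) where
  mul_zero := by
    intro i j x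
    obtain ⟨a, rfl⟩ := mk_surjective x
    rw [← mk_zero, gMul_mk_mk, ← mk_zero]
    exact congrArg mk (Subtype.ext (by simp [mulRep]))
  zero_mul := by
    intro i j x
    obtain ⟨a, rfl⟩ := mk_surjective x
    rw [← mk_zero, gMul_mk_mk, ← mk_zero]
    exact congrArg mk (Subtype.ext (by simp [mulRep]))
  mul_add := by
    intro i j x y z
    obtain ⟨a, rfl⟩ := mk_surjective x
    obtain ⟨b, rfl⟩ := mk_surjective y
    obtain ⟨c, rfl⟩ := mk_surjective z
    rw [← mk_add, gMul_mk_mk, gMul_mk_mk, gMul_mk_mk, ← mk_add]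
    exact congrArg mk (Subtype.ext (by simp [mulRep, mul_add]))
  add_mul := by
    intro i j x y z
    obtain ⟨a, rfl⟩ := mk_surjective x
    obtain ⟨b, rfl⟩ := mk_surjective y
    obtain ⟨c, rfl⟩ := mk_surjective z
    rw [← mk_add, gMul_mk_mk, gMul_mk_mk, gMul_mk_mk, ← mk_add]
    exact congrArg mk (Subtype.ext (by simp [mulRep, add_mul]))
  one_mul := by
    rintro ⟨i, x⟩
    obtain ⟨a, rfl⟩ := mk_surjective x
    change GradedMonoid.mk _ (mul (mk (zeroRep 1)) (mk a)) = GradedMonoid.mk _ (mk a)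
    rw [mul_mk_mk]
    exact sigma_mk_eq (by simp) _ _ (by simp [mulRep, zeroRep])
  mul_one := by
    rintro ⟨i, x⟩
    obtain ⟨a, rfl⟩ := mk_surjective x
    change GradedMonoid.mk _ (mul (mk a) (mk (zeroRep 1))) = GradedMonoid.mk _ (mk a)
    rw [mul_mk_mk]
    exact sigma_mk_eq (by simp) _ _ (by simp [mulRep, zeroRep])
  mul_assoc := by
    rintro ⟨i, x⟩ ⟨j, y⟩ ⟨k, z⟩
    obtain ⟨a, rfl⟩ := mk_surjective x
    obtain ⟨b, rfl⟩ := mk_surjective y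
    obtain ⟨c, rfl⟩ := mk_surjective z
    change GradedMonoid.mk _ (mul (mul (mk a) (mk b)) (mk c)) =
      GradedMonoid.mk _ (mul (mk a) (mul (mk b) (mk c)))
    simp only [mul_mk_mk]
    exact sigma_mk_eq (add_assoc i j k) _ _ (by simp [mulRep, mul_assoc])
  mul_comm := by
    rintro ⟨i, x⟩ ⟨j, y⟩
    obtain ⟨a, rfl⟩ := mk_surjective x
    obtain ⟨b, rfl⟩ := mk_surjective y
    change GradedMonoid.mk _ (mul (mk a) (mk b)) = GradedMonoid.mk _ (mul (mk b) (mk a))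
    simp only [mul_mk_mk]
    exact sigma_mk_eq (add_comm i j) _ _ (by simp [mulRep, mul_comm])
  natCast := fun n => mk (zeroRep (n : A))
  natCast_zero := by
    rw [← mk_zero]
    exact congrArg mk (Subtype.ext (by simp [zeroRep]))
  natCast_succ := by
    intro n
    change mk _ = mk _ + mk (zeroRep 1)
    rw [← mk_add]
    exact congrArg mk (Subtype.ext (by simp [zeroRep]))
  intCast := fun n => mk (zeroRep (n : A))
  intCast_ofNat := by
    intro n
    exact congrArg mk (Subtype.ext (by simp [zeroRep]))
  intCast_negSucc_ofNat := by
    intro n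
    change mk _ = mk (-(zeroRep ((n + 1 : ℕ) : A)))
    exact congrArg mk (Subtype.ext (by simp [zeroRep]))

instance gAlgebra {K : Type u} [CommRing K] [Algebra K A] :
    DirectSum.GAlgebra K (GrPiece I) where
  toFun :=
    { toFun := fun k => mk (zeroRep (algebraMap K A k))
      map_zero' := by
        rw [← mk_zero]
        exact congrArg mk (Subtype.ext (by simp [zeroRep]))
      map_add' := fun k l => by
        rw [← mk_add]
        exact congrArg mk (Subtype.ext (by simp [zeroRep])) }
  map_one := congrArg mk (Subtype.ext (by simp [zeroRep]))
  map_mul := by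
    intro k l
    change GradedMonoid.mk _ (mk (zeroRep (algebraMap K A (k * l)))) =
      GradedMonoid.mk _ (mul (mk (zeroRep (algebraMap K A k))) (mk (zeroRep (algebraMap K A l))))
    rw [mul_mk_mk]
    exact sigma_mk_eq (by simp) _ _ (by simp [mulRep, zeroRep])
  commutes := by
    rintro k ⟨i, x⟩
    obtain ⟨a, rfl⟩ := mk_surjective x
    change GradedMonoid.mk _ (mul (mk (zeroRep (algebraMap K A k))) (mk a)) =
      GradedMonoid.mk _ (mul (mk a) (mk (zeroRep (algebraMap K A k))))
    rw [mul_mk_mk, mul_mk_mk]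
    exact sigma_mk_eq (by simp) _ _ (by simp [mulRep, zeroRep, mul_comm])
  smul_def := by
    rintro k ⟨i, x⟩
    obtain ⟨a, rfl⟩ := mk_surjective x
    change GradedMonoid.mk _ (mk (k • a)) =
      GradedMonoid.mk _ (mul (mk (zeroRep (algebraMap K A k))) (mk a))
    rw [mul_mk_mk]
    exact sigma_mk_eq (by simp) _ _ (by simp [mulRep, zeroRep, Algebra.smul_def])

end GrPiece

/-- The associated graded ring `A / I ⊕ I / I ^ 2 ⊕ I ^ 2 / I ^ 3 ⊕ ⋯` of an ideal `I`. -/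
abbrev AssocGraded {A : Type v} [CommRing A] (I : Ideal A) : Type v :=
  ⨁ n : ℕ, GrPiece I n

/-- For a grading `𝒜` of the `K`-algebra `A`, the grading that the associated graded ring of a
homogeneous ideal `I` inherits from `A`: its degree-`i` component is the direct sum over `j` of
the images of `I ^ j ∩ 𝒜 i` in `I ^ j / I ^ (j + 1)`. -/
def AssocGraded.grading {K : Type u} {A : Type v} [Field K] [CommRing A] [Algebra K A]
    (𝒜 : ℕ → Submodule K A) (I : Ideal A) (i : ℕ) : Submodule K (AssocGraded I) :=
  ⨆ j : ℕ, Submodule.map (DirectSum.lof K ℕ (GrPiece I) j ∘ₗ GrPiece.mkLinear K I j)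
    (Submodule.comap ((I ^ j).subtype.restrictScalars K) (𝒜 i))

/-- The graded `K`-algebra `A = ⨁ 𝒜 i` is standard graded: `𝒜 0 = K` (and `A ≠ 0`), and `A` is
generated by `𝒜 1` as a `K`-algebra. -/
structure IsStandardGraded {K : Type u} {A : Type v} [Field K] [CommRing A] [Algebra K A]
    (𝒜 : ℕ → Submodule K A) [GradedAlgebra 𝒜] : Prop where
  nontrivial : Nontrivial A
  zero_eq : 𝒜 0 = 1
  adjoin_one : Algebra.adjoin K (𝒜 1 : Set A) = ⊤

/-- Weak Lefschetz property of `A = 𝒜 0 ⊕ ⋯ ⊕ 𝒜 c`, `𝒜 c ≠ 0`. -/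
def HasWLP {K : Type u} {A : Type v} [Field K] [CommRing A] [Algebra K A]
    (𝒜 : ℕ → Submodule K A) : Prop :=
  ∃ c : ℕ, IsGreatest {i : ℕ | 𝒜 i ≠ ⊥} c ∧
    ∃ g ∈ 𝒜 1, ∀ i < c,
      Set.InjOn (fun a => g * a) (𝒜 i : Set A) ∨
        Set.SurjOn (fun a => g * a) (𝒜 i : Set A) (𝒜 (i + 1) : Set A)

/-- Strong Lefschetz property of `A = 𝒜 0 ⊕ ⋯ ⊕ 𝒜 c`, `𝒜 c ≠ 0`. -/
def HasSLP {K : Type u} {A : Type v} [Field K] [CommRing A] [Algebra K A]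
    (𝒜 : ℕ → Submodule K A) : Prop :=
  ∃ c : ℕ, IsGreatest {i : ℕ | 𝒜 i ≠ ⊥} c ∧
    ∃ g ∈ 𝒜 1, ∀ i ≤ c / 2,
      Set.BijOn (fun a => g ^ (c - 2 * i) * a) (𝒜 i : Set A) (𝒜 (c - i) : Set A)

end

/-!
Write `I = (z)` with `z` a linear form, and `G` for the associated graded ring of `I`. Each `𝒜 i`
carries the finite decreasing filtration by the `I ^ j ∩ 𝒜 i`, which vanishes for `j > i` because
`z` has degree `1`. Choosing compatible projections `ρ j` onto complements of
`I ^ (j + 1) ∩ 𝒜 i` in `I ^ j ∩ 𝒜 i` (`FiltrationSplitting`) identifies `𝒜 i` with the degree-`i`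
component of `G` by `x ↦ ∑ j, [ρ j x]` (`FiltrationSplitting.toAssocGraded`). In particular `A` and
`G` have the same top degree.

*From `G` to `A`.* A linear form `g` of `G` is `[y] + [w]` with `y ∈ 𝒜 1` of filtration level `0`
and `w ∈ 𝒜 1 ∩ I` of level `1`. Let `D t` act on the `j`-th summand of a split filtration as `t ^ j`.
Multiplication by `(y + t⁻¹ w) ^ k`, conjugated as `D t ∘ - ∘ (D t)⁻¹`, is polynomial in `t`: its
expansion consists of the terms `t⁻ᵐ • binom(k, m) w ^ m y ^ (k - m)`, the `m`-th of which raises the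
filtration level by at least `m`. The value at `t = 0` keeps only the parts raising the level by
exactly `m`, that is, it is multiplication by `g ^ k` on `G`
(`symb_pow_mul_toAssocGraded`). Composed with a one-sided inverse of its value at `0`, the family has
as determinant a polynomial in `t` with value `1` at `0`. So if `g ^ k` is injective or surjective
on a component, the same holds for `(y + s w) ^ k` for all but finitely many `s`
(`exists_finite_exceptions`). As the Lefschetz properties concern finitely many maps and `K` is
infinite, one `s` serves them all.

*From `A` to `G`.* If `z` is a Lefschetz element of `A`, its class in `I / I ^ 2` is one of `G` for
`I = (z)`: powers of it are injective or surjective wherever those of `z` are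
(`injOn_symb_pow_mul`, `surjOn_symb_pow_mul`).
-/

/-! ### Polynomial families of linear maps -/

section FiniteExceptions

variable {K M N : Type*} [Field K] [AddCommGroup M] [Module K M]
  [AddCommGroup N] [Module K N]

/-- A polynomial family of endomorphisms that is invertible at `0` is invertible away from finitely
many parameters. The convention `0 ^ 0 = 1` makes `t = 0` pick out the constant terms. -/
theorem finite_setOf_det_eq_zero [FiniteDimensional K M] {ι : Type*} (S : Finset ι)
    (e : ι → ℕ) (P : ι → M →ₗ[K] M)
    (h : LinearMap.det (∑ a ∈ S, (0 : K) ^ e a • P a) ≠ 0) :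
    {t : K | LinearMap.det (∑ a ∈ S, t ^ e a • P a) = 0}.Finite := by
  classical
  let b := Module.finBasis K M
  -- The matrix of the family over `K[X]`; its determinant interpolates the determinants.
  let Q : Matrix _ _ (Polynomial K) :=
    ∑ a ∈ S, (Polynomial.X ^ e a : Polynomial K) •
      (LinearMap.toMatrix b b (P a)).map Polynomial.C
  have key : ∀ t : K, Q.det.eval t = LinearMap.det (∑ a ∈ S, t ^ e a • P a) := by
    intro t
    rw [← LinearMap.det_toMatrix b, ← Polynomial.coe_evalRingHom, RingHom.map_det]
    congr 1
    ext i j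
    simp only [Q, LinearMap.toMatrix_apply, RingHom.mapMatrix_apply, Matrix.map_apply,
      Matrix.sum_apply, Matrix.smul_apply, smul_eq_mul, Polynomial.coe_evalRingHom,
      Polynomial.eval_mul, Polynomial.eval_pow, Polynomial.eval_X,
      Polynomial.eval_C, LinearMap.sum_apply, LinearMap.smul_apply, map_sum, map_smul,
      Finsupp.coe_finsetSum, Finset.sum_apply, Finsupp.smul_apply]
  have hQ : Q.det ≠ 0 := by
    intro h0
    apply h
    rw [← key, h0, Polynomial.eval_zero]
  refine (Q.det.roots.toFinset.finite_toSet).subset ?_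
  intro t ht
  simpa [hQ, key] using ht

theorem finite_setOf_not_injective [FiniteDimensional K M] {ι : Type*} (S : Finset ι)
    (e : ι → ℕ) (P : ι → M →ₗ[K] N)
    (h : Function.Injective (∑ a ∈ S, (0 : K) ^ e a • P a : M →ₗ[K] N)) :
    {t : K | ¬ Function.Injective (∑ a ∈ S, t ^ e a • P a : M →ₗ[K] N)}.Finite := by
  obtain ⟨g, hg⟩ := LinearMap.exists_leftInverse_of_injective _ (LinearMap.ker_eq_bot.mpr h)
  have key : ∀ t : K, ∑ a ∈ S, t ^ e a • (g ∘ₗ P a) = g ∘ₗ ∑ a ∈ S, t ^ e a • P a := by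
    intro t
    ext x
    simp
  refine (finite_setOf_det_eq_zero S e (fun a => g ∘ₗ P a) ?_).subset ?_
  · rw [key, hg]
    simp
  · intro t ht
    by_contra h0
    apply ht
    have hi : Function.Injective (g ∘ₗ ∑ a ∈ S, t ^ e a • P a) := by
      rw [← key]
      exact (LinearMap.equivOfDetNeZero _ h0).injective
    rw [LinearMap.coe_comp] at hi
    exact hi.of_comp

theorem finite_setOf_not_surjective [FiniteDimensional K N] {ι : Type*} (S : Finset ι)
    (e : ι → ℕ) (P : ι → M →ₗ[K] N)
    (h : Function.Surjective (∑ a ∈ S, (0 : K) ^ e a • P a : M →ₗ[K] N)) :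
    {t : K | ¬ Function.Surjective (∑ a ∈ S, t ^ e a • P a : M →ₗ[K] N)}.Finite := by
  obtain ⟨g, hg⟩ := LinearMap.exists_rightInverse_of_surjective _ (LinearMap.range_eq_top.mpr h)
  have key : ∀ t : K, ∑ a ∈ S, t ^ e a • (P a ∘ₗ g) = (∑ a ∈ S, t ^ e a • P a) ∘ₗ g := by
    intro t
    ext x
    simp
  refine (finite_setOf_det_eq_zero S e (fun a => P a ∘ₗ g) ?_).subset ?_
  · rw [key, hg]
    simp
  · intro t ht
    by_contra h0
    apply ht
    have hi : Function.Surjective ((∑ a ∈ S, t ^ e a • P a) ∘ₗ g) := by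
      rw [← key]
      exact (LinearMap.equivOfDetNeZero _ h0).surjective
    rw [LinearMap.coe_comp] at hi
    exact hi.of_comp

/-- A property that holds at `t⁻¹` for almost all `t ≠ 0` holds almost everywhere. -/
theorem finite_setOf_not_of_inv {p : K → Prop} {S : Set K} (hS : S.Finite)
    (h : ∀ t, t ≠ 0 → t ∉ S → p t⁻¹) : {s | ¬ p s}.Finite := by
  refine ((hS.image (·⁻¹)).insert 0).subset ?_
  intro s hs
  by_cases h0 : s = 0
  · exact Or.inl h0
  · refine Or.inr ⟨s⁻¹, ?_, inv_inv s⟩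
    by_contra hn
    exact hs (by simpa using h s⁻¹ (inv_ne_zero h0) hn)

/-! ### Splittings of filtrations -/

/-- A splitting of a decreasing filtration `F`: pairwise orthogonal idempotents `proj j`, where
`proj j` is a projection onto a complement of `F (j + 1)` in `F j`. They sum to the identity when `F`
is finite. -/
structure FiltrationSplitting (F : ℕ → Submodule K M) where
  proj : ℕ → M →ₗ[K] M
  proj_mem : ∀ j x, proj j x ∈ F j
  proj_of_mem : ∀ {i j x}, x ∈ F j → i < j → proj i x = 0
  sub_proj_mem : ∀ {j x}, x ∈ F j → x - proj j x ∈ F (j + 1)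
  proj_proj : ∀ j x, proj j (proj j x) = proj j x
  proj_proj_of_ne : ∀ {i j}, i ≠ j → ∀ x, proj i (proj j x) = 0
  sum_proj : ∀ {n}, F n = ⊥ → ∀ x, ∑ j ∈ Finset.range n, proj j x = x

/-- The projections are differences `p j - p (j + 1)`, where `p j` is a projection onto `F j` built
as a composite of projections onto `F j, F (j - 1), …, F 1`, so that `p i ∘ p j = p (max i j)`. -/
theorem FiltrationSplitting.exists_of_antitone (F : ℕ → Submodule K M) (hF : Antitone F)
    (h0 : F 0 = ⊤) : Nonempty (FiltrationSplitting F) := by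
  choose r hr using fun j => (F j).subtype.exists_leftInverse_of_injective (F j).ker_subtype
  let p : ℕ → M →ₗ[K] M := fun j =>
    Nat.rec LinearMap.id (fun j q => (F (j + 1)).subtype ∘ₗ r (j + 1) ∘ₗ q) j
  have ps : ∀ j x, p (j + 1) x = (r (j + 1) (p j x) : M) := fun j x => rfl
  have hr' : ∀ {j x}, x ∈ F j → (r j x : M) = x := fun {j x} hx =>
    congrArg Subtype.val (LinearMap.congr_fun (hr j) ⟨x, hx⟩)
  have pmem : ∀ j x, p j x ∈ F j := by
    rintro (_ | j) x
    · simp [h0]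
    · rw [ps]
      exact (r (j + 1) (p j x)).2
  have pid : ∀ j x, x ∈ F j → p j x = x := by
    intro j
    induction j with
    | zero => intro x _; rfl
    | succ j ih =>
      intro x hx
      rw [ps, ih x (hF (Nat.le_succ j) hx), hr' hx]
  have ple : ∀ {i j}, i ≤ j → ∀ x, p i (p j x) = p j x := fun h x =>
    pid _ _ (hF h (pmem _ x))
  have pge : ∀ {i j}, i ≤ j → ∀ x, p j (p i x) = p j x := by
    intro i j h x
    induction j, h using Nat.le_induction with
    | base => exact ple le_rfl x
    | succ j h ih => rw [ps, ps, ih]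
  refine ⟨⟨fun j => p j - p (j + 1), ?_, ?_, ?_, ?_, ?_, ?_⟩⟩
  · intro j x
    exact sub_mem (pmem j x) (hF (Nat.le_succ j) (pmem (j + 1) x))
  · intro i j x hx h
    simp [pid i x (hF h.le hx), pid (i + 1) x (hF h hx)]
  · intro j x hx
    simpa [pid j x hx] using pmem (j + 1) x
  · intro j x
    simp [ple le_rfl, ple (Nat.le_succ j), pge (Nat.le_succ j)]
  · intro i j h x
    rcases lt_or_gt_of_ne h with h | h
    · simp [ple (show i ≤ j by omega), ple (show i ≤ j + 1 by omega),
        ple (show i + 1 ≤ j by omega), ple (show i + 1 ≤ j + 1 by omega)]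
    · simp [pge (show j ≤ i by omega), pge (show j + 1 ≤ i by omega),
        pge (show j ≤ i + 1 by omega), pge (show j + 1 ≤ i + 1 by omega)]
  · intro n hn x
    have hpn : p n x = 0 := by simpa [hn] using pmem n x
    have : ∑ j ∈ Finset.range n, (p j x - p (j + 1) x) = p 0 x - p n x :=
      Finset.sum_range_sub' (fun j => p j x) n
    rw [hpn, sub_zero] at this
    exact this

namespace FiltrationSplitting

variable {F : ℕ → Submodule K M} {G : ℕ → Submodule K N}

/-- Scaling the summands of a split filtration by `b j` is inverted by scaling them by `a j`. -/
theorem sum_smul_sum_smul (ρ : FiltrationSplitting F) {n : ℕ} (hn : F n = ⊥) {a b : ℕ → K}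
    (hab : ∀ j, a j * b j = 1) (x : M) :
    ∑ i ∈ Finset.range n, a i • ρ.proj i (∑ j ∈ Finset.range n, b j • ρ.proj j x) = x := by
  conv_rhs => rw [← ρ.sum_proj hn x]
  refine Finset.sum_congr rfl fun i hi => ?_
  rw [map_sum, Finset.sum_eq_single i]
  · rw [map_smul, ρ.proj_proj, smul_smul, hab, one_smul]
  · intro j _ hji
    rw [map_smul, ρ.proj_proj_of_ne hji.symm, smul_zero]
  · exact fun h => absurd hi h

/-- For `f(s) = ∑ m ≤ k, s ^ m • f m`, where `f m` raises filtration levels by at least `m`, the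
polynomial family in `t` that for `t ≠ 0` equals `D t ∘ f(t⁻¹) ∘ (D t)⁻¹`, with `D t` acting as `t ^ j`
on the `j`-th summand (see `rescaledMap_eq`). At `t = 0` it is the associated graded map of `f(1)`.
The bounds `n` and `n'` are the lengths of the filtrations. The truncated exponent is harmless: for
`l < j + m` the operator `proj l ∘ f m ∘ proj j` vanishes. -/
def rescaledMap (ρ : FiltrationSplitting F) (π : FiltrationSplitting G) (n n' k : ℕ)
    (f : ℕ → M →ₗ[K] N) (t : K) : M →ₗ[K] N :=
  ∑ a ∈ Finset.range n ×ˢ Finset.range n' ×ˢ Finset.range (k + 1),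
    t ^ (a.2.1 - (a.1 + a.2.2)) • (π.proj a.2.1 ∘ₗ f a.2.2 ∘ₗ ρ.proj a.1)

theorem rescaledMap_apply (ρ : FiltrationSplitting F) (π : FiltrationSplitting G) (n n' k : ℕ)
    (f : ℕ → M →ₗ[K] N) (t : K) (x : M) :
    rescaledMap ρ π n n' k f t x = ∑ j ∈ Finset.range n, ∑ l ∈ Finset.range n',
      ∑ m ∈ Finset.range (k + 1), t ^ (l - (j + m)) • π.proj l (f m (ρ.proj j x)) := by
  simp [rescaledMap, Finset.sum_product]

theorem rescaledMap_eq (ρ : FiltrationSplitting F) (π : FiltrationSplitting G) (n n' k : ℕ)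
    {f : ℕ → M →ₗ[K] N} (hf : ∀ m j, ∀ x ∈ F j, f m x ∈ G (j + m)) {t : K} (ht : t ≠ 0)
    (x : M) :
    rescaledMap ρ π n n' k f t x = ∑ l ∈ Finset.range n', t ^ l • π.proj l
      ((∑ m ∈ Finset.range (k + 1), t⁻¹ ^ m • f m)
        (∑ j ∈ Finset.range n, t⁻¹ ^ j • ρ.proj j x)) := by
  rw [rescaledMap_apply, Finset.sum_comm]
  refine Finset.sum_congr rfl fun l _ => ?_
  simp only [map_sum, Finset.smul_sum]
  refine Finset.sum_congr rfl fun j _ => ?_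
  simp only [LinearMap.sum_apply, map_sum, Finset.smul_sum, LinearMap.smul_apply, map_smul,
    smul_smul]
  refine Finset.sum_congr rfl fun m _ => ?_
  by_cases h : j + m ≤ l
  · congr 1
    obtain ⟨d, rfl⟩ := Nat.exists_eq_add_of_le h
    rw [Nat.add_sub_cancel_left]
    rw [inv_pow, inv_pow, pow_add, pow_add]
    field_simp
  · rw [π.proj_of_mem (hf m j _ (ρ.proj_mem j x)) (not_le.mp h), smul_zero, smul_zero]

theorem finite_setOf_not_injective [FiniteDimensional K M] (ρ : FiltrationSplitting F)
    (π : FiltrationSplitting G) {n n' : ℕ} (k : ℕ) (hn : F n = ⊥)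
    {f : ℕ → M →ₗ[K] N} (hf : ∀ m j, ∀ x ∈ F j, f m x ∈ G (j + m))
    (h : Function.Injective (rescaledMap ρ π n n' k f 0)) :
    {s : K | ¬ Function.Injective (∑ m ∈ Finset.range (k + 1), s ^ m • f m : M →ₗ[K] N)}.Finite := by
  refine finite_setOf_not_of_inv (_root_.finite_setOf_not_injective _ _ _ h) fun t ht hi => ?_
  have hi : Function.Injective (rescaledMap ρ π n n' k f t) := not_not.mp hi
  intro x y hxy
  have e : ∀ x : M, ∑ j ∈ Finset.range n, t⁻¹ ^ j • ρ.proj j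
      (∑ j ∈ Finset.range n, t ^ j • ρ.proj j x) = x :=
    ρ.sum_smul_sum_smul hn fun j => by rw [← mul_pow, inv_mul_cancel₀ ht, one_pow]
  have hd : ∑ j ∈ Finset.range n, t ^ j • ρ.proj j x =
      ∑ j ∈ Finset.range n, t ^ j • ρ.proj j y := by
    apply hi
    rw [rescaledMap_eq ρ π n n' k hf ht, rescaledMap_eq ρ π n n' k hf ht, e, e, hxy]
  rw [← e x, hd, e y]

theorem finite_setOf_not_surjective [FiniteDimensional K N] (ρ : FiltrationSplitting F)
    (π : FiltrationSplitting G) {n n' : ℕ} (k : ℕ) (hn' : G n' = ⊥)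
    {f : ℕ → M →ₗ[K] N} (hf : ∀ m j, ∀ x ∈ F j, f m x ∈ G (j + m))
    (h : Function.Surjective (rescaledMap ρ π n n' k f 0)) :
    {s : K | ¬ Function.Surjective (∑ m ∈ Finset.range (k + 1), s ^ m • f m : M →ₗ[K] N)}.Finite := by
  refine finite_setOf_not_of_inv (_root_.finite_setOf_not_surjective _ _ _ h) fun t ht hi => ?_
  have hi : Function.Surjective (rescaledMap ρ π n n' k f t) := not_not.mp hi
  intro y
  obtain ⟨x, hx⟩ := hi (∑ l ∈ Finset.range n', t ^ l • π.proj l y)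
  have e : ∀ x : N, ∑ j ∈ Finset.range n', t⁻¹ ^ j • π.proj j
      (∑ j ∈ Finset.range n', t ^ j • π.proj j x) = x :=
    π.sum_smul_sum_smul hn' fun j => by rw [← mul_pow, inv_mul_cancel₀ ht, one_pow]
  refine ⟨∑ j ∈ Finset.range n, t⁻¹ ^ j • ρ.proj j x, ?_⟩
  rw [← e y, ← hx, rescaledMap_eq ρ π n n' k hf ht, e]

end FiltrationSplitting

end FiniteExceptions

/-! ### Homogeneous elements of the associated graded ring -/

namespace AssocGraded

variable {A : Type v} [CommRing A] {I : Ideal A}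

/-- The class of `a ∈ I ^ j` in the summand `I ^ j / I ^ (j + 1)` of the associated graded ring. -/
def symb (I : Ideal A) (j : ℕ) (a : A) (h : a ∈ I ^ j) : AssocGraded I :=
  DirectSum.of (GrPiece I) j (GrPiece.mk ⟨a, h⟩)

theorem symb_add {j : ℕ} {a b : A} (ha : a ∈ I ^ j) (hb : b ∈ I ^ j) :
    symb I j (a + b) (add_mem ha hb) = symb I j a ha + symb I j b hb :=
  (congrArg (DirectSum.of (GrPiece I) j) (GrPiece.mk_add ⟨a, ha⟩ ⟨b, hb⟩)).trans
    (map_add _ _ _)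

theorem symb_smul {K : Type u} [Field K] [Algebra K A] {j : ℕ} {a : A} (ha : a ∈ I ^ j) (c : K) :
    symb I j (c • a) (Submodule.smul_of_tower_mem _ c ha) = c • symb I j a ha :=
  (congrArg (DirectSum.of (GrPiece I) j) (GrPiece.mk_smul c ⟨a, ha⟩)).trans
    ((DirectSum.lof K ℕ (GrPiece I) j).map_smul c (GrPiece.mk ⟨a, ha⟩))

theorem symb_eq_symb_iff {j : ℕ} {a b : A} {ha : a ∈ I ^ j} {hb : b ∈ I ^ j} :
    symb I j a ha = symb I j b hb ↔ a - b ∈ I ^ (j + 1) :=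
  (DirectSum.of_injective j).eq_iff.trans GrPiece.mk_eq_mk

theorem symb_eq_zero_iff {j : ℕ} {a : A} {ha : a ∈ I ^ j} :
    symb I j a ha = 0 ↔ a ∈ I ^ (j + 1) := by
  have h0 : symb I j 0 (zero_mem _) = 0 :=
    (congrArg (DirectSum.of (GrPiece I) j) GrPiece.mk_zero).trans (map_zero _)
  rw [← h0, symb_eq_symb_iff, sub_zero]

theorem symb_congr {j j' : ℕ} (hj : j = j') {a a' : A} (ha : a = a') (h : a ∈ I ^ j) :
    symb I j a h = symb I j' a' (hj ▸ ha ▸ h) := by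
  subst hj ha
  rfl

theorem symb_mul {j k : ℕ} {a b : A} (ha : a ∈ I ^ j) (hb : b ∈ I ^ k) :
    symb I j a ha * symb I k b hb =
      symb I (j + k) (a * b) (by rw [pow_add]; exact Ideal.mul_mem_mul ha hb) := by
  rw [symb, symb, DirectSum.of_mul_of, GrPiece.gMul_mk_mk]
  rfl

theorem symb_pow_mul {d j : ℕ} {a b : A} (ha : a ∈ I ^ d) (hb : b ∈ I ^ j) (k : ℕ) :
    symb I d a ha ^ k * symb I j b hb = symb I (j + d * k) (a ^ k * b) (by
      rw [pow_add, mul_comm (a ^ k), pow_mul]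
      exact Ideal.mul_mem_mul hb (Ideal.pow_mem_pow ha k)) := by
  induction k with
  | zero =>
    rw [pow_zero, one_mul]
    exact symb_congr (by simp) (by simp) _
  | succ k ih =>
    rw [pow_succ', mul_assoc, ih, symb_mul]
    exact symb_congr (by ring) (by ring) _

theorem symb_natCast_mul {j : ℕ} {a : A} (ha : a ∈ I ^ j) (n : ℕ) :
    (n : AssocGraded I) * symb I j a ha = symb I j (n * a) (Ideal.mul_mem_left _ _ ha) := by
  induction n with
  | zero =>
    rw [Nat.cast_zero, zero_mul, eq_comm, symb_eq_zero_iff]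
    simp
  | succ n ih =>
    rw [Nat.cast_succ, add_mul, one_mul, ih, ← symb_add]
    exact symb_congr rfl (by push_cast; ring) _

end AssocGraded

/-- The coefficient of `s ^ m` in `(y + s w) ^ k`; it is `0` for `m > k`. -/
def binomialTerm {A : Type v} [CommRing A] (y w : A) (k m : ℕ) : A :=
  (k.choose m : A) * (w ^ m * y ^ (k - m))

/-! ### Binomial expansion of powers of linear forms -/

section BinomialTerm

variable {A : Type v} [CommRing A] {I : Ideal A} {y w : A}

theorem binomialTerm_mul_mem (hw : w ∈ I) (k m : ℕ) {j : ℕ} {a : A} (ha : a ∈ I ^ j) :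
    binomialTerm y w k m * a ∈ I ^ (j + m) := by
  rw [show binomialTerm y w k m * a = (k.choose m : A) * y ^ (k - m) * (a * w ^ m) by
    rw [binomialTerm]; ring, pow_add]
  exact Ideal.mul_mem_left _ _ (Ideal.mul_mem_mul ha (Ideal.pow_mem_pow hw m))

theorem symb_add_symb_pow_mul (hy : y ∈ I ^ 0) (hw : w ∈ I ^ 1) (k : ℕ) {j : ℕ} {a : A}
    (ha : a ∈ I ^ j) :
    (AssocGraded.symb I 0 y hy + AssocGraded.symb I 1 w hw) ^ k * AssocGraded.symb I j a ha =
      ∑ m ∈ Finset.range (k + 1), AssocGraded.symb I (j + m) (binomialTerm y w k m * a)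
        (binomialTerm_mul_mem (by simpa using hw) k m ha) := by
  rw [add_comm, add_pow, Finset.sum_mul]
  refine Finset.sum_congr rfl fun m _ => ?_
  rw [mul_comm (_ * _) (Nat.cast _), mul_assoc, mul_assoc, AssocGraded.symb_pow_mul,
    AssocGraded.symb_pow_mul, AssocGraded.symb_natCast_mul]
  exact AssocGraded.symb_congr (by ring) (by rw [binomialTerm]; ring) _

theorem add_smul_pow {K : Type u} [Field K] [Algebra K A] (s : K) (k : ℕ) :
    (y + s • w) ^ k = ∑ m ∈ Finset.range (k + 1), s ^ m • binomialTerm y w k m := by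
  rw [add_comm, add_pow]
  refine Finset.sum_congr rfl fun m _ => ?_
  rw [smul_pow, binomialTerm, smul_mul_assoc, smul_mul_assoc, mul_comm (_ * _)]

end BinomialTerm

/-! ### Splitting a graded component along the powers of an ideal -/

section Graded

variable {K : Type u} {A : Type v} [Field K] [CommRing A] [Algebra K A]
  (𝒜 : ℕ → Submodule K A)

theorem Submodule.injOn_mul_iff (S : Submodule K A) (g : A) :
    Set.InjOn (fun a => g * a) (S : Set A) ↔ ∀ x ∈ S, g * x = 0 → x = 0 := by
  constructor
  · intro h x hx h0
    exact h hx S.zero_mem (by simpa using h0)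
  · intro h x hx y hy hxy
    refine sub_eq_zero.mp (h _ (S.sub_mem hx hy) ?_)
    rw [mul_sub]
    exact sub_eq_zero.mpr hxy

/-- If `𝒜 0 = K`, the ideal generated by a subspace `V` of `𝒜 i` meets `𝒜 i` in `V`, so subspaces of
`𝒜 i` inherit the ascending chain condition from ideals of `A`. -/
theorem finiteDimensional_of_zero_eq_one [GradedAlgebra 𝒜] [IsArtinianRing A] (h0 : 𝒜 0 = 1)
    (i : ℕ) : FiniteDimensional K (𝒜 i) := by
  have key : ∀ V : Submodule K (𝒜 i), ∀ x ∈ Ideal.span ((↑) '' (V : Set (𝒜 i)) : Set A),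
      ∀ a : A, DirectSum.decompose 𝒜 (a * x) i ∈ V := by
    intro V x hx
    induction hx using Submodule.span_induction with
    | mem x hx =>
      obtain ⟨v, hv, rfl⟩ := hx
      intro a
      have ha : (DirectSum.decompose 𝒜 a 0 : A) ∈ (1 : Submodule K A) :=
        h0 ▸ (DirectSum.decompose 𝒜 a 0).2
      obtain ⟨c, hc⟩ := Submodule.mem_one.mp ha
      have e : DirectSum.decompose 𝒜 (a * v) i = c • v := by
        refine Subtype.ext ?_
        rw [DirectSum.coe_decompose_mul_of_right_mem_of_le 𝒜 v.2 le_rfl, Nat.sub_self, ← hc,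
          ← Algebra.smul_def]
        rfl
      rw [e]
      exact V.smul_mem c hv
    | zero => simp
    | add x y _ _ hx hy =>
      intro a
      rw [mul_add, DirectSum.decompose_add]
      exact V.add_mem (hx a) (hy a)
    | smul b x _ hx =>
      intro a
      rw [smul_eq_mul, ← mul_assoc]
      exact hx (a * b)
  have hle : ∀ V W : Submodule K (𝒜 i),
      Ideal.span ((↑) '' (V : Set (𝒜 i)) : Set A) ≤ Ideal.span ((↑) '' (W : Set (𝒜 i))) →
        V ≤ W := by
    intro V W h v hv
    have := key W v (h (Ideal.subset_span ⟨v, hv, rfl⟩)) 1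
    rwa [one_mul, DirectSum.decompose_coe, DirectSum.of_eq_same] at this
  have hmono : StrictMono fun V : Submodule K (𝒜 i) =>
      Ideal.span ((↑) '' (V : Set (𝒜 i)) : Set A) := fun V W h =>
    lt_of_le_not_ge (Ideal.span_mono (Set.image_mono h.le)) fun h' => h.not_ge (hle W V h')
  exact IsNoetherian.iff_fg.mp (isNoetherian_mk hmono.wellFoundedGT)

/-- The subspaces `I ^ j ∩ 𝒜 i` of `𝒜 i`, as a filtration indexed by `j`. -/
def idealFiltration (I : Ideal A) (i j : ℕ) : Submodule K (𝒜 i) :=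
  Submodule.comap (𝒜 i).subtype ((I ^ j).restrictScalars K)

variable {𝒜} {I : Ideal A}

theorem mem_idealFiltration {i j : ℕ} {x : 𝒜 i} :
    x ∈ idealFiltration 𝒜 I i j ↔ (x : A) ∈ I ^ j := Iff.rfl

theorem idealFiltration_antitone (i : ℕ) : Antitone (idealFiltration 𝒜 I i) :=
  fun _ _ h _ hx => Ideal.pow_le_pow_right h hx

theorem idealFiltration_zero (i : ℕ) : idealFiltration 𝒜 I i 0 = ⊤ := by
  ext x
  simp [mem_idealFiltration]

theorem exists_filtrationSplitting (𝒜 : ℕ → Submodule K A) (I : Ideal A) (i : ℕ) :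
    Nonempty (FiltrationSplitting (idealFiltration 𝒜 I i)) :=
  FiltrationSplitting.exists_of_antitone _ (idealFiltration_antitone i) (idealFiltration_zero i)

theorem symb_mem_grading {i j : ℕ} {a : A} (ha : a ∈ 𝒜 i) (h : a ∈ I ^ j) :
    AssocGraded.symb I j a h ∈ AssocGraded.grading 𝒜 I i :=
  Submodule.mem_iSup_of_mem j ⟨⟨a, h⟩, ha, rfl⟩

theorem grading_le {i : ℕ} {S : Submodule K (AssocGraded I)}
    (h : ∀ j a (ha : a ∈ I ^ j), a ∈ 𝒜 i → AssocGraded.symb I j a ha ∈ S) :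
    AssocGraded.grading 𝒜 I i ≤ S := by
  refine iSup_le fun j => ?_
  rintro _ ⟨⟨a, ha⟩, hi, rfl⟩
  exact h j a ha hi

namespace FiltrationSplitting

variable {i : ℕ} (ρ : FiltrationSplitting (idealFiltration 𝒜 I i))

theorem coe_proj_mem (j : ℕ) (x : 𝒜 i) : (ρ.proj j x : A) ∈ I ^ j := ρ.proj_mem j x

/-- The map `x ↦ ∑ j, [proj j x]` from `𝒜 i` to the associated graded ring. The range of `j` suffices
when `I ^ (i + 1) ∩ 𝒜 i = 0`, and then it is an isomorphism onto the degree-`i` component. -/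
def toAssocGraded : 𝒜 i →ₗ[K] AssocGraded I where
  toFun x := ∑ j ∈ Finset.range (i + 1), AssocGraded.symb I j (ρ.proj j x) (ρ.coe_proj_mem j x)
  map_add' x y := by
    rw [← Finset.sum_add_distrib]
    refine Finset.sum_congr rfl fun j _ => ?_
    rw [← AssocGraded.symb_add]
    exact AssocGraded.symb_congr rfl (by simp) _
  map_smul' c x := by
    rw [Finset.smul_sum]
    refine Finset.sum_congr rfl fun j _ => ?_
    rw [RingHom.id_apply, ← AssocGraded.symb_smul]
    exact AssocGraded.symb_congr rfl (by simp) _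

theorem toAssocGraded_apply (x : 𝒜 i) : ρ.toAssocGraded x =
    ∑ j ∈ Finset.range (i + 1), AssocGraded.symb I j (ρ.proj j x) (ρ.coe_proj_mem j x) := rfl

theorem toAssocGraded_proj (hbot : idealFiltration 𝒜 I i (i + 1) = ⊥) {j : ℕ} {v : 𝒜 i}
    (hv : v ∈ idealFiltration 𝒜 I i j) :
    ρ.toAssocGraded (ρ.proj j v) = AssocGraded.symb I j v (mem_idealFiltration.mp hv) := by
  rw [toAssocGraded_apply, Finset.sum_eq_single j]
  · rw [AssocGraded.symb_eq_symb_iff, ρ.proj_proj]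
    have h := neg_mem (ρ.sub_proj_mem hv)
    rw [neg_sub] at h
    exact h
  · intro l _ hl
    rw [AssocGraded.symb_eq_zero_iff, ρ.proj_proj_of_ne hl]
    exact zero_mem _
  · intro hj
    have h0 : v = 0 := by
      have := idealFiltration_antitone i (show i + 1 ≤ j by simpa using hj) hv
      simpa [hbot] using this
    subst h0
    rw [AssocGraded.symb_eq_zero_iff, map_zero, map_zero]
    exact zero_mem _

theorem toAssocGraded_mem (x : 𝒜 i) : ρ.toAssocGraded x ∈ AssocGraded.grading 𝒜 I i := by
  rw [toAssocGraded_apply]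
  exact Submodule.sum_mem _ fun j _ => symb_mem_grading (ρ.proj j x).2 (ρ.coe_proj_mem j x)

theorem exists_toAssocGraded_eq (hbot : idealFiltration 𝒜 I i (i + 1) = ⊥)
    {X : AssocGraded I} (hX : X ∈ AssocGraded.grading 𝒜 I i) : ∃ x, ρ.toAssocGraded x = X :=
  grading_le (S := LinearMap.range ρ.toAssocGraded)
    (fun j a ha hi => ⟨ρ.proj j ⟨a, hi⟩, ρ.toAssocGraded_proj hbot (v := ⟨a, hi⟩) ha⟩) hX

theorem sum_symb_eq_zero_iff {n : ℕ} {e : ℕ} {a : ℕ → A} (ha : ∀ j, a j ∈ I ^ (j + e)) :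
    ∑ j ∈ Finset.range n, AssocGraded.symb I (j + e) (a j) (ha j) = 0 ↔
      ∀ j < n, a j ∈ I ^ (j + e + 1) := by
  constructor
  · intro h j hj
    rw [← AssocGraded.symb_eq_zero_iff (ha := ha j)]
    have h1 := congrArg (fun X : AssocGraded I => X (j + e)) h
    simp only [DirectSum.sum_apply] at h1
    rw [Finset.sum_eq_single j] at h1
    · rw [AssocGraded.symb, DirectSum.of_eq_same] at h1
      rw [AssocGraded.symb, h1]
      exact map_zero _
    · intro l _ hl
      exact DirectSum.of_eq_of_ne _ _ _ (by omega)
    · intro h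
      exact absurd (Finset.mem_range.mpr hj) h
  · intro h
    exact Finset.sum_eq_zero fun j hj =>
      AssocGraded.symb_eq_zero_iff.mpr (h j (Finset.mem_range.mp hj))

theorem toAssocGraded_injective (hbot : idealFiltration 𝒜 I i (i + 1) = ⊥) :
    Function.Injective ρ.toAssocGraded := by
  rw [injective_iff_map_eq_zero]
  intro x hx
  rw [← ρ.sum_proj hbot x]
  refine Finset.sum_eq_zero fun j hj => ?_
  have h := (sum_symb_eq_zero_iff (e := 0) (fun j => ρ.coe_proj_mem j x)).mp hx j
    (Finset.mem_range.mp hj)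
  rw [← ρ.proj_proj j x]
  exact ρ.proj_of_mem (j := j + 1) h (Nat.lt_succ_self j)

end FiltrationSplitting

/-- Multiplication by `c` as a linear map between graded components. -/
def gradedMul {i i' : ℕ} (c : A) (hc : ∀ x ∈ 𝒜 i, c * x ∈ 𝒜 i') : 𝒜 i →ₗ[K] 𝒜 i' :=
  (LinearMap.mulLeft K c).restrict hc

theorem coe_gradedMul {i i' : ℕ} (c : A) (hc : ∀ x ∈ 𝒜 i, c * x ∈ 𝒜 i') (x : 𝒜 i) :
    (gradedMul c hc x : A) = c * x := rfl

theorem binomialTerm_mul_mem_graded [SetLike.GradedMonoid 𝒜] {y w : A} (hy : y ∈ 𝒜 1)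
    (hw : w ∈ 𝒜 1) (k m : ℕ) {i i' : ℕ} (hi : k + i = i') :
    ∀ x ∈ 𝒜 i, binomialTerm y w k m * x ∈ 𝒜 i' := by
  subst hi
  intro x hx
  refine SetLike.mul_mem_graded ?_ hx
  rw [binomialTerm]
  by_cases hm : m ≤ k
  · rw [← nsmul_eq_mul]
    refine nsmul_mem ?_ _
    have := SetLike.mul_mem_graded (SetLike.pow_mem_graded m hw)
      (SetLike.pow_mem_graded (k - m) hy)
    simpa [hm] using this
  · rw [Nat.choose_eq_zero_of_lt (not_le.mp hm)]
    simp

/-- Under the identification of graded components of `A` with those of the associated graded ring,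
multiplication by `([y] + [w]) ^ k` is the value at `0` of the rescaled family of the multiplications by
`(y + s w) ^ k`. -/
theorem symb_pow_mul_toAssocGraded [SetLike.GradedMonoid 𝒜] {y w : A} (hy : y ∈ 𝒜 1)
    (hw : w ∈ 𝒜 1) (hyI : y ∈ I ^ 0) (hwI : w ∈ I ^ 1) (k : ℕ) {i i' : ℕ} (hi : k + i = i')
    (ρ : FiltrationSplitting (idealFiltration 𝒜 I i))
    (π : FiltrationSplitting (idealFiltration 𝒜 I i'))
    (hbot : idealFiltration 𝒜 I i' (i' + 1) = ⊥) (x : 𝒜 i) :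
    (AssocGraded.symb I 0 y hyI + AssocGraded.symb I 1 w hwI) ^ k * ρ.toAssocGraded x =
      π.toAssocGraded (ρ.rescaledMap π (i + 1) (i' + 1) k
        (fun m => gradedMul _ (binomialTerm_mul_mem_graded hy hw k m hi)) 0 x) := by
  rw [ρ.rescaledMap_apply, map_sum, ρ.toAssocGraded_apply, Finset.mul_sum]
  refine Finset.sum_congr rfl fun j _ => ?_
  rw [symb_add_symb_pow_mul, Finset.sum_comm, map_sum]
  refine Finset.sum_congr rfl fun m _ => ?_
  set v : 𝒜 i' := gradedMul _ (binomialTerm_mul_mem_graded hy hw k m hi) (ρ.proj j x) with hvdef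
  have hv : v ∈ idealFiltration 𝒜 I i' (j + m) :=
    binomialTerm_mul_mem (by simpa using hwI) k m (ρ.proj_mem j x)
  rw [Finset.sum_eq_single (j + m)]
  · rw [Nat.sub_self, pow_zero, one_smul, π.toAssocGraded_proj hbot hv]
    rfl
  · intro l _ hl
    rcases lt_or_gt_of_ne hl with hl | hl
    · rw [π.proj_of_mem hv hl, smul_zero]
    · rw [zero_pow (by omega), zero_smul]
  · intro hj
    have h0 : v = 0 := by
      have := idealFiltration_antitone i' (show i' + 1 ≤ j + m by simpa using hj) hv
      simpa [hbot] using this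
    rw [h0, map_zero, smul_zero]

end Graded

/-! ### The associated graded ring of a linear form -/

section Principal

variable {K : Type u} {A : Type v} [Field K] [CommRing A] [Algebra K A]
  {𝒜 : ℕ → Submodule K A} [GradedAlgebra 𝒜] {z : A}

theorem idealFiltration_span_singleton_eq_bot (hz : z ∈ 𝒜 1) {i j : ℕ} (hij : i < j) :
    idealFiltration 𝒜 (Ideal.span {z}) i j = ⊥ := by
  rw [eq_bot_iff]
  intro x hx
  rw [mem_idealFiltration, Ideal.span_singleton_pow, Ideal.mem_span_singleton] at hx
  obtain ⟨b, hb⟩ := hx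
  have hzj : z ^ j ∈ 𝒜 j := by simpa using SetLike.pow_mem_graded j hz
  have h := DirectSum.coe_decompose_mul_of_left_mem_of_not_le 𝒜 (b := b) hzj (not_le.mpr hij)
  rw [← hb, DirectSum.decompose_coe, DirectSum.of_eq_same] at h
  exact Subtype.ext h

theorem grading_eq_bot_iff (hz : z ∈ 𝒜 1) (i : ℕ) :
    AssocGraded.grading 𝒜 (Ideal.span {z}) i = ⊥ ↔ 𝒜 i = ⊥ := by
  obtain ⟨ρ⟩ := exists_filtrationSplitting 𝒜 (Ideal.span {z}) i
  have hbot := idealFiltration_span_singleton_eq_bot hz (Nat.lt_succ_self i)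
  rw [Submodule.eq_bot_iff, Submodule.eq_bot_iff]
  constructor
  · intro h x hx
    have h0 := h _ (ρ.toAssocGraded_mem ⟨x, hx⟩)
    exact congrArg Subtype.val (ρ.toAssocGraded_injective hbot (h0.trans (map_zero _).symm))
  · intro h X hX
    obtain ⟨x, rfl⟩ := ρ.exists_toAssocGraded_eq hbot hX
    rw [show x = 0 from Subtype.ext (h x x.2), map_zero]

/-- Every linear form `g` of the associated graded ring comes with a line `y + s w` of linear forms of
`A` whose powers, for almost all `s`, are injective or surjective wherever those of `g` are. -/
theorem exists_finite_exceptions [∀ i, FiniteDimensional K (𝒜 i)] (hz : z ∈ 𝒜 1)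
    {g : AssocGraded (Ideal.span {z})} (hg : g ∈ AssocGraded.grading 𝒜 (Ideal.span {z}) 1) :
    ∃ y ∈ 𝒜 1, ∃ w ∈ 𝒜 1, ∀ i k i' : ℕ, k + i = i' →
      (Set.InjOn (fun a => g ^ k * a)
          (AssocGraded.grading 𝒜 (Ideal.span {z}) i : Set (AssocGraded (Ideal.span {z}))) →
        {s : K | ¬ Set.InjOn (fun a => (y + s • w) ^ k * a) (𝒜 i : Set A)}.Finite) ∧
      (Set.SurjOn (fun a => g ^ k * a)
          (AssocGraded.grading 𝒜 (Ideal.span {z}) i : Set (AssocGraded (Ideal.span {z})))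
          (AssocGraded.grading 𝒜 (Ideal.span {z}) i' : Set (AssocGraded (Ideal.span {z}))) →
        {s : K | ¬ Set.SurjOn (fun a => (y + s • w) ^ k * a) (𝒜 i : Set A)
          (𝒜 i' : Set A)}.Finite) := by
  have hbot : ∀ i, idealFiltration 𝒜 (Ideal.span {z}) i (i + 1) = ⊥ := fun i =>
    idealFiltration_span_singleton_eq_bot hz (Nat.lt_succ_self i)
  obtain ⟨τ⟩ := exists_filtrationSplitting 𝒜 (Ideal.span {z}) 1
  obtain ⟨x, rfl⟩ := τ.exists_toAssocGraded_eq (hbot 1) hg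
  refine ⟨τ.proj 0 x, (τ.proj 0 x).2, τ.proj 1 x, (τ.proj 1 x).2, ?_⟩
  intro i k i' hi
  obtain ⟨ρ⟩ := exists_filtrationSplitting 𝒜 (Ideal.span {z}) i
  obtain ⟨π⟩ := exists_filtrationSplitting 𝒜 (Ideal.span {z}) i'
  have hg : τ.toAssocGraded x =
      AssocGraded.symb (Ideal.span {z}) 0 (τ.proj 0 x) (τ.coe_proj_mem 0 x) +
        AssocGraded.symb (Ideal.span {z}) 1 (τ.proj 1 x) (τ.coe_proj_mem 1 x) := by
    rw [τ.toAssocGraded_apply, Finset.sum_range_succ, Finset.sum_range_one]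
  have hmul := symb_pow_mul_toAssocGraded (τ.proj 0 x).2 (τ.proj 1 x).2 (τ.coe_proj_mem 0 x)
    (τ.coe_proj_mem 1 x) k hi ρ π (hbot i')
  rw [hg]
  have hw : (τ.proj 1 x : A) ∈ Ideal.span {z} := by simpa using τ.coe_proj_mem 1 x
  -- Only the memberships of the two representatives matter from here on.
  generalize (τ.proj 0 x).2 = hy1, (τ.proj 1 x).2 = hw1 at *
  generalize τ.coe_proj_mem 0 x = hyI, τ.coe_proj_mem 1 x = hwI at *
  generalize (τ.proj 0 x : A) = y, (τ.proj 1 x : A) = w at *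
  set f : ℕ → 𝒜 i →ₗ[K] 𝒜 i' :=
    fun m => gradedMul _ (binomialTerm_mul_mem_graded hy1 hw1 k m hi) with hf
  have hfF : ∀ m j, ∀ a ∈ idealFiltration 𝒜 (Ideal.span {z}) i j,
      f m a ∈ idealFiltration 𝒜 (Ideal.span {z}) i' (j + m) := fun m j a ha =>
    binomialTerm_mul_mem hw k m ha
  have hpow : ∀ (s : K) (a : 𝒜 i),
      ((∑ m ∈ Finset.range (k + 1), s ^ m • f m) a : A) = (y + s • w) ^ k * a := by
    intro s a
    rw [add_smul_pow, Finset.sum_mul]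
    simp [hf, coe_gradedMul]
  constructor
  · intro hinj
    refine (ρ.finite_setOf_not_injective π k (hbot i) hfF (n' := i' + 1) ?_).subset ?_
    · intro a b hab
      apply ρ.toAssocGraded_injective (hbot i)
      apply hinj (ρ.toAssocGraded_mem a) (ρ.toAssocGraded_mem b)
      simp only [hmul, hab]
    · intro s hs h
      refine hs fun a ha b hb hab => ?_
      refine congrArg Subtype.val (@h ⟨a, ha⟩ ⟨b, hb⟩ (Subtype.ext ?_))
      rw [hpow, hpow]
      exact hab
  · intro hsurj
    refine (ρ.finite_setOf_not_surjective π k (hbot i') hfF (n := i + 1) ?_).subset ?_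
    · intro b
      obtain ⟨X, hX, hXb⟩ := hsurj (π.toAssocGraded_mem b)
      obtain ⟨a, rfl⟩ := ρ.exists_toAssocGraded_eq (hbot i) hX
      refine ⟨a, π.toAssocGraded_injective (hbot i') ?_⟩
      rw [← hmul]
      exact hXb
    · intro s hs h
      refine hs fun b hb => ?_
      obtain ⟨a, ha⟩ := h ⟨b, hb⟩
      exact ⟨a, a.2, (hpow s a).symm.trans (congrArg Subtype.val ha)⟩

/-- A cofactor of `z ^ k` in a homogeneous element can be replaced by its homogeneous component, which
stays in the homogeneous ideal `(z) ^ j`. -/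
theorem exists_mem_of_pow_mul_mem (hz : z ∈ 𝒜 1) {i k j : ℕ} {a b : A} (ha : a ∈ 𝒜 (k + i))
    (hb : b ∈ Ideal.span {z} ^ j) (h : a = z ^ k * b) :
    ∃ p ∈ 𝒜 i, p ∈ Ideal.span {z} ^ j ∧ a = z ^ k * p := by
  have hzk : z ^ k ∈ 𝒜 k := by simpa using SetLike.pow_mem_graded k hz
  refine ⟨DirectSum.decompose 𝒜 b i, SetLike.coe_mem _, ?_, ?_⟩
  · rw [Ideal.span_singleton_pow] at hb ⊢
    refine Ideal.homogeneous_span 𝒜 {z ^ j} ?_ i hb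
    rintro _ rfl
    exact ⟨j, by simpa using SetLike.pow_mem_graded j hz⟩
  · have := DirectSum.coe_decompose_mul_of_left_mem_of_le 𝒜 (b := b) hzk (Nat.le_add_right k i)
    rwa [← h, DirectSum.decompose_of_mem_same 𝒜 ha, Nat.add_sub_cancel_left] at this

theorem injOn_symb_pow_mul (hz : z ∈ 𝒜 1) (hzI : z ∈ Ideal.span {z} ^ 1) {i k : ℕ}
    (h : Set.InjOn (fun a => z ^ k * a) (𝒜 i : Set A)) :
    Set.InjOn (fun a => AssocGraded.symb _ 1 z hzI ^ k * a)
      (AssocGraded.grading 𝒜 (Ideal.span {z}) i : Set (AssocGraded (Ideal.span {z}))) := by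
  rw [Submodule.injOn_mul_iff] at h ⊢
  intro X hX h0
  obtain ⟨ρ⟩ := exists_filtrationSplitting 𝒜 (Ideal.span {z}) i
  have hbot := idealFiltration_span_singleton_eq_bot hz (Nat.lt_succ_self i)
  obtain ⟨x, rfl⟩ := ρ.exists_toAssocGraded_eq hbot hX
  have hm : ∀ j, z ^ k * (ρ.proj j x : A) ∈ Ideal.span {z} ^ (j + k) := fun j => by
    rw [mul_comm, pow_add]
    exact Ideal.mul_mem_mul (ρ.coe_proj_mem j x)
      (Ideal.pow_mem_pow (Ideal.mem_span_singleton_self z) k)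
  have h1 : ∑ j ∈ Finset.range (i + 1),
      AssocGraded.symb _ (j + k) (z ^ k * (ρ.proj j x : A)) (hm j) = 0 := by
    rw [← h0, ρ.toAssocGraded_apply, Finset.mul_sum]
    refine Finset.sum_congr rfl fun j _ => ?_
    rw [AssocGraded.symb_pow_mul]
    exact AssocGraded.symb_congr (by ring) rfl _
  rw [FiltrationSplitting.sum_symb_eq_zero_iff] at h1
  rw [ρ.toAssocGraded_apply]
  refine Finset.sum_eq_zero fun j hj => AssocGraded.symb_eq_zero_iff.mpr ?_
  have h2 := h1 j (Finset.mem_range.mp hj)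
  rw [Ideal.span_singleton_pow, Ideal.mem_span_singleton] at h2
  obtain ⟨b, hb⟩ := h2
  have hzk : z ^ k ∈ 𝒜 k := by simpa using SetLike.pow_mem_graded k hz
  -- `z ^ k * ρ j x ∈ I ^ (j + k + 1)`, and cancelling `z ^ k` puts `ρ j x` into `I ^ (j + 1)`.
  obtain ⟨p, hp, hpI, hpe⟩ := exists_mem_of_pow_mul_mem hz
    (SetLike.mul_mem_graded hzk (ρ.proj j x).2) (b := z ^ (j + 1) * b) (j := j + 1)
    (Ideal.mul_mem_right _ _ (Ideal.pow_mem_pow (Ideal.mem_span_singleton_self z) _))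
    (by rw [hb]; ring)
  have h3 := h _ (sub_mem (ρ.proj j x).2 hp) (by rw [mul_sub, hpe, sub_self])
  rwa [sub_eq_zero.mp h3]

theorem surjOn_symb_pow_mul (hz : z ∈ 𝒜 1) (hzI : z ∈ Ideal.span {z} ^ 1) {i k i' : ℕ}
    (hi : k + i = i') (h : Set.SurjOn (fun a => z ^ k * a) (𝒜 i : Set A) (𝒜 i' : Set A)) :
    Set.SurjOn (fun a => AssocGraded.symb _ 1 z hzI ^ k * a)
      (AssocGraded.grading 𝒜 (Ideal.span {z}) i : Set (AssocGraded (Ideal.span {z})))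
      (AssocGraded.grading 𝒜 (Ideal.span {z}) i' : Set (AssocGraded (Ideal.span {z}))) := by
  subst hi
  suffices AssocGraded.grading 𝒜 (Ideal.span {z}) (k + i) ≤
      (AssocGraded.grading 𝒜 (Ideal.span {z}) i).map
        (LinearMap.mulLeft K (AssocGraded.symb _ 1 z hzI ^ k)) from this
  refine grading_le fun j a ha hai => ?_
  by_cases hkj : k ≤ j
  · obtain ⟨d, rfl⟩ := Nat.exists_eq_add_of_le' hkj
    have ha' := ha
    rw [Ideal.span_singleton_pow, Ideal.mem_span_singleton] at ha'
    obtain ⟨b, hb⟩ := ha'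
    obtain ⟨p, hp, hpI, hpe⟩ := exists_mem_of_pow_mul_mem hz hai (b := z ^ d * b) (j := d)
      (Ideal.mul_mem_right _ _ (Ideal.pow_mem_pow (Ideal.mem_span_singleton_self z) _))
      (by rw [hb]; ring)
    refine ⟨_, symb_mem_grading hp hpI, ?_⟩
    rw [LinearMap.mulLeft_apply, AssocGraded.symb_pow_mul]
    exact AssocGraded.symb_congr (by ring) hpe.symm _
  -- By surjectivity `a ∈ I ^ k`, so its class in level `j < k` is zero.
  · obtain ⟨b, _, hb⟩ := h hai
    have h0 : AssocGraded.symb (Ideal.span {z}) j a ha = 0 := by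
      rw [AssocGraded.symb_eq_zero_iff, ← hb]
      exact Ideal.mul_mem_right _ _ (Ideal.pow_le_pow_right (show j + 1 ≤ k by omega)
        (Ideal.pow_mem_pow (Ideal.mem_span_singleton_self z) k))
    rw [h0]
    exact zero_mem _

end Principal

/-! ### Transfer of the Lefschetz properties -/

section Lefschetz

variable {K : Type u} {A : Type v} [Field K] [CommRing A] [Algebra K A]
  {𝒜 : ℕ → Submodule K A} [GradedAlgebra 𝒜] {z : A}

theorem isGreatest_grading_iff (hz : z ∈ 𝒜 1) (c : ℕ) :
    IsGreatest {i : ℕ | AssocGraded.grading 𝒜 (Ideal.span {z}) i ≠ ⊥} c ↔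
      IsGreatest {i : ℕ | 𝒜 i ≠ ⊥} c := by
  simp only [ne_eq, grading_eq_bot_iff hz]

theorem HasWLP.exists_grading (h : HasWLP 𝒜) :
    ∃ z ∈ 𝒜 1, HasWLP (AssocGraded.grading 𝒜 (Ideal.span {z})) := by
  obtain ⟨c, hc, z, hz, h⟩ := h
  have hzI : z ∈ Ideal.span {z} ^ 1 := by simp
  refine ⟨z, hz, c, (isGreatest_grading_iff hz c).mpr hc, _, symb_mem_grading hz hzI, ?_⟩
  intro i hi
  have hinj := injOn_symb_pow_mul (i := i) (k := 1) hz hzI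
  have hsurj := surjOn_symb_pow_mul (k := 1) hz hzI (add_comm 1 i)
  simp only [pow_one] at hinj hsurj
  exact (h i hi).imp hinj hsurj

theorem HasSLP.exists_grading (h : HasSLP 𝒜) :
    ∃ z ∈ 𝒜 1, HasSLP (AssocGraded.grading 𝒜 (Ideal.span {z})) := by
  obtain ⟨c, hc, z, hz, h⟩ := h
  have hzI : z ∈ Ideal.span {z} ^ 1 := by simp
  refine ⟨z, hz, c, (isGreatest_grading_iff hz c).mpr hc, _, symb_mem_grading hz hzI, ?_⟩
  intro i hi
  have hic : c - 2 * i + i = c - i := by omega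
  refine ⟨?_, injOn_symb_pow_mul hz hzI (h i hi).injOn,
    surjOn_symb_pow_mul hz hzI hic (h i hi).surjOn⟩
  refine (grading_le (S := (AssocGraded.grading 𝒜 (Ideal.span {z}) (c - i)).comap
    (LinearMap.mulLeft K (AssocGraded.symb _ 1 z hzI ^ (c - 2 * i)))) ?_ :)
  intro j a ha hai
  rw [Submodule.mem_comap, LinearMap.mulLeft_apply, AssocGraded.symb_pow_mul]
  exact symb_mem_grading ((h i hi).mapsTo hai) _

theorem HasWLP.of_grading [Infinite K] [∀ i, FiniteDimensional K (𝒜 i)] (hz : z ∈ 𝒜 1)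
    (h : HasWLP (AssocGraded.grading 𝒜 (Ideal.span {z}))) : HasWLP 𝒜 := by
  obtain ⟨c, hc, g, hg, h⟩ := h
  obtain ⟨y, hy, w, hw, hyw⟩ := exists_finite_exceptions hz hg
  have hfin : ∀ i < c, {s : K | ¬ (Set.InjOn (fun a => (y + s • w) * a) (𝒜 i : Set A) ∨
      Set.SurjOn (fun a => (y + s • w) * a) (𝒜 i : Set A) (𝒜 (i + 1) : Set A))}.Finite := by
    intro i hi
    have h1 := hyw i 1 (i + 1) (add_comm 1 i)
    simp only [pow_one] at h1
    rcases h i hi with h2 | h2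
    · exact (h1.1 h2).subset fun s hs => (not_or.mp hs).1
    · exact (h1.2 h2).subset fun s hs => (not_or.mp hs).2
  obtain ⟨s, hs⟩ := ((Set.finite_Iio c).biUnion hfin).exists_notMem
  refine ⟨c, (isGreatest_grading_iff hz c).mp hc, y + s • w,
    add_mem hy ((𝒜 1).smul_mem s hw), fun i hi => ?_⟩
  by_contra hn
  exact hs (Set.mem_biUnion hi hn)

theorem HasSLP.of_grading [Infinite K] [∀ i, FiniteDimensional K (𝒜 i)] (hz : z ∈ 𝒜 1)
    (h : HasSLP (AssocGraded.grading 𝒜 (Ideal.span {z}))) : HasSLP 𝒜 := by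
  obtain ⟨c, hc, g, hg, h⟩ := h
  obtain ⟨y, hy, w, hw, hyw⟩ := exists_finite_exceptions hz hg
  have hic : ∀ i ≤ c / 2, c - 2 * i + i = c - i := fun i hi => by omega
  have hfin : ∀ i ≤ c / 2,
      ({s : K | ¬ Set.InjOn (fun a => (y + s • w) ^ (c - 2 * i) * a) (𝒜 i : Set A)} ∪
        {s : K | ¬ Set.SurjOn (fun a => (y + s • w) ^ (c - 2 * i) * a) (𝒜 i : Set A)
          (𝒜 (c - i) : Set A)}).Finite := by
    intro i hi
    have h1 := hyw i _ _ (hic i hi)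
    exact (h1.1 (h i hi).injOn).union (h1.2 (h i hi).surjOn)
  obtain ⟨s, hs⟩ := ((Set.finite_Iic (c / 2)).biUnion hfin).exists_notMem
  have hl : y + s • w ∈ 𝒜 1 := add_mem hy ((𝒜 1).smul_mem s hw)
  refine ⟨c, (isGreatest_grading_iff hz c).mp hc, y + s • w, hl, fun i hi => ⟨?_, ?_, ?_⟩⟩
  · intro a ha
    have := SetLike.mul_mem_graded (SetLike.pow_mem_graded (c - 2 * i) hl) ha
    rwa [smul_eq_mul, mul_one, hic i hi] at this
  · by_contra hn
    exact hs (Set.mem_biUnion hi (Or.inl hn))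
  · by_contra hn
    exact hs (Set.mem_biUnion hi (Or.inr hn))

end Lefschetz

theorem mainTheorem1 {K : Type u} {A : Type v} [Field K] [CharZero K] [CommRing A] [Algebra K A]
    [IsArtinianRing A] (𝒜 : ℕ → Submodule K A) [GradedAlgebra 𝒜] (hA : IsStandardGraded 𝒜) :
    (HasWLP 𝒜 ↔ ∃ z ∈ 𝒜 1, HasWLP (AssocGraded.grading 𝒜 (Ideal.span {z}))) ∧
      (HasSLP 𝒜 ↔ ∃ z ∈ 𝒜 1, HasSLP (AssocGraded.grading 𝒜 (Ideal.span {z}))) := by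
  have : ∀ i, FiniteDimensional K (𝒜 i) := finiteDimensional_of_zero_eq_one 𝒜 hA.zero_eq
  exact ⟨⟨HasWLP.exists_grading, fun ⟨_, hz, h⟩ => h.of_grading hz⟩,
    ⟨HasSLP.exists_grading, fun ⟨_, hz, h⟩ => h.of_grading hz⟩⟩
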